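/- Let $n \ge 1$ be an integer. A monochromatic component of an edge-coloring of a complete graph is a connected component of the spanning subgraph formed by all edges of one color (a vertex isolated in a color forms a one-vertex component of that color). Let $M(n,r)$ denote the largest integer $m$ such that every coloring of the edges of $K_n$ with $r$ colors has a monochromatic component with at least $m$ edges. Gyárfás's construction (for four colors) is the 4-coloring of the edges of $K_9$ whose vertices are the points of the affine plane $\mathbb{F}_3^2$, in which an edge is colored by which of $x$, $y$, $x+y$, $x-y$ is constant on the line through its two ends; thus each color class is a union of three vertex-disjoint triangles. A 4-coloring of $K_n$ is said to match Gyárfás's construction if there are a permutation of the colors and a bijection from its monochromatic components to those of Gyárfás's construction that respects colors up to this permutation and such that any family of components has a common vertex if and only if the corresponding family has a common vertex. Theorem. In every 4-coloring of the edges of $K_n$ there is a monochromatic component with at least $\frac{1}{12}\binom{n}{2}$ edges; that is, $$M(n,4) \ge \left\lceil \tfrac{1}{12}\tbinom{n}{2} \right\rceil .$$ Moreover, every 4-coloring of the edges of $K_n$ that does not match Gyárfás's construction has a monochromatic component with at least $\left(\frac{1}{12}+\varepsilon\right)\binom{n}{2}$ edges, where $$\varepsilon = \frac{2}{14+\sqrt{96}}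 - \frac{1}{12} > 0.0007 .$$ -/

import Mathlib

namespace ColoredComponents

open SimpleGraph

/-- A monochromatic connected component of an edge-coloring `c` of the complete graph on `V`:
a color `k` together with a connected component of the spanning graph formed by the edges of
color `k` (a vertex that is isolated in color `k` forms a one-vertex component). -/
abbrev MonoComponent {V K : Type*} (c : TopEdgeLabeling V K) : Type _ :=
  Σ k : K, (c.labelGraph k).ConnectedComponent

namespace MonoComponent

variable {V K : Type*} {c : TopEdgeLabeling V K}

/-- The color of a monochromatic component. -/
def color (C : MonoComponent c) : K := C.1

/-- The vertex set of a monochromatic component. -/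
def verts (C : MonoComponent c) : Set V := C.2.supp

/-- The number of edges of a monochromatic component. -/
noncomputable def numEdges (C : MonoComponent c) : ℕ := C.2.toSimpleGraph.edgeSet.ncard

end MonoComponent

/-- The set of all `m` such that every `r`-edge-coloring of `K_n` has a monochromatic component
with at least `m` edges. -/
def guaranteed (n r : ℕ) : Set ℕ :=
  {m | ∀ c : TopEdgeLabeling (Fin n) (Fin r), ∃ C : MonoComponent c, m ≤ C.numEdges}

/-- `M n r` is the largest `m` such that every `r`-edge-coloring of `K_n` has a monochromatic
component with at least `m` edges. -/
noncomputable def M (n r : ℕ) : ℕ := sSup (guaranteed n r)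

/-- For `n, r ≥ 1` the maximum in the definition of `M n r` exists. -/
theorem isGreatest_M (n r : ℕ) (hn : 1 ≤ n) (hr : 1 ≤ r) : IsGreatest (guaranteed n r) (M n r) := by
  have : NeZero r := ⟨by omega⟩
  have hne : (guaranteed n r).Nonempty :=
    ⟨0, fun c => ⟨⟨0, SimpleGraph.connectedComponentMk _ ⟨0, hn⟩⟩, Nat.zero_le _⟩⟩
  have hbd : BddAbove (guaranteed n r) := by
    let c : TopEdgeLabeling (Fin n) (Fin r) := fun _ => 0
    have : Finite (MonoComponent c) :=
      inferInstanceAs (Finite (Σ k : Fin r, (c.labelGraph k).ConnectedComponent))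
    obtain ⟨B, hB⟩ := (Set.finite_range (fun C : MonoComponent c => C.numEdges)).bddAbove
    refine ⟨B, fun m hm => ?_⟩
    obtain ⟨C, hC⟩ := hm c
    exact hC.trans (hB ⟨C, rfl⟩)
  exact ⟨Nat.sSup_mem hne hbd, fun m hm => le_csSup hbd hm⟩

/-- Two edge-colorings of (possibly different) complete graphs have the same component structure:
up to a permutation of the colors, there is a bijection between their monochromatic components
under which the intersection patterns of the vertex sets agree, that is, a family of components
of the first coloring has a common vertex if and only if the corresponding family of components
of the second one has a common vertex. -/
def SameComponentStructure {V W K : Type*} (c : TopEdgeLabeling V K)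
    (d : TopEdgeLabeling W K) : Prop :=
  ∃ (σ : Equiv.Perm K) (f : MonoComponent c ≃ MonoComponent d),
    (∀ C, (f C).color = σ C.color) ∧
    ∀ S : Set (MonoComponent c),
      (⋂ C ∈ S, C.verts).Nonempty ↔ (⋂ C ∈ S, (f C).verts).Nonempty

/-- The direction of the line through two distinct points of the affine plane of order 3:
`x` constant, `y` constant, `x + y` constant, or (otherwise) `x - y` constant. -/
def direction (p q : ZMod 3 × ZMod 3) : Fin 4 :=
  if p.1 = q.1 then 0 else if p.2 = q.2 then 1 else if p.1 + p.2 = q.1 + q.2 then 2 else 3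

/-- Gyárfás's construction for four colors: the vertices of `K_9` are the points of the affine
plane of order 3, and an edge is colored by the parallel class of the line through its ends. -/
def gyarfas : TopEdgeLabeling (ZMod 3 × ZMod 3) (Fin 4) :=
  EdgeLabeling.mk (fun p q _ => direction p q) (by
    have h : ∀ p q : ZMod 3 × ZMod 3, direction q p = direction p q := by decide
    intro p q _
    exact h p q)

/-- In Gyárfás's construction, two distinct points are joined in color `k` if and only if they
lie on a common line of the `k`-th parallel class. -/
theorem gyarfas_adj (k : Fin 4) (p q : ZMod 3 × ZMod 3) :
    (gyarfas.labelGraph k).Adj p q ↔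
      p ≠ q ∧ ![p.1, p.2, p.1 + p.2, p.1 - p.2] k = ![q.1, q.2, q.1 + q.2, q.1 - q.2] k := by
  have h : ∀ (k : Fin 4) (p q : ZMod 3 × ZMod 3), p ≠ q → (direction p q = k ↔
      ![p.1, p.2, p.1 + p.2, p.1 - p.2] k = ![q.1, q.2, q.1 + q.2, q.1 - q.2] k) := by decide
  rw [EdgeLabeling.labelGraph_adj]
  constructor
  · rintro ⟨hpq, e⟩
    exact ⟨hpq, (h k p q hpq).1 e⟩
  · rintro ⟨hpq, e⟩
    exact ⟨hpq, (h k p q hpq).2 e⟩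

end ColoredComponents

namespace ColoredComponents

open Finset SimpleGraph

/-! Attach to each vertex the word of its four monochromatic components, one per color. The edge
between two vertices puts both into one component of its color, so any two words agree somewhere.
What remains is a statement about intersecting sets of words of length four, plus edge counting.

Combinatorial part (`IsIntersecting.hasSmallCover_or_isAffinePlane`): for some `t`, fewer than
`coverBound t` components meet every word at least `t` times, or the words form the affine plane of
order 3. The proof is a finite case analysis. It starts from two distinct words of maximal
agreement, branches on which patterns of known and fresh names occur, and is checked by the kernel;
`CaseTree.check_sound` turns a successful check into the claim. The plane arises only when distinct
words agree in exactly one place.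

Counting part (`exists_numEdges_ge_of_hasSmallCover`): suppose all components have fewer than `B`
edges, and let `s (s - 1) = 2 B`. Each of the `k` covering components has fewer than `B` edges. The
others have orders summing to at most `(4 - t) n`, and one of order `m` has at most `(s - 1) m / 2`
edges. With `ρ = 1 + √6` and `2 B ρ² = n (n - 1)` this contradicts `k + (4 - t) ρ ≤ ρ²`, which
`coverBound` guarantees.

In the affine case the coloring matches Gyárfás's construction, so it has at most twelve components
and averaging gives `1/12`. -/

/-- A word records, for each of the four colors, the name of a monochromatic component. -/
abbrev Word := Fin 4 → ℕ

/-- The number of coordinates in which two words agree. -/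
def agree (u w : Word) : ℕ := #{i | u i = w i}

/-- Any two words of the set agree in some coordinate. -/
def IsIntersecting (H : Set Word) : Prop := ∀ u ∈ H, ∀ w ∈ H, 1 ≤ agree u w

/-- A set of named components that meets every word at least `t` times is small if it has fewer
than `coverBound t` elements. -/
def coverBound : ℕ → ℕ
  | 1 => 2
  | 2 => 6
  | 3 => 9
  | 4 => 12
  -- No set has fewer than 0 elements, so only `1 ≤ t ≤ 4` can occur.
  | _ => 0

/-- Some small set of named components meets every word of `H` at least `t` times. -/
def HasSmallCover (H : Set Word) : Prop :=
  ∃ (S : Finset (Fin 4 × ℕ)) (t : ℕ), #S < coverBound t ∧ ∀ w ∈ H, t ≤ #{i | (i, w i) ∈ S}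

/-- The four coordinates of a point of the affine plane of order 3, one for each parallel class. -/
def lineCoord (p : ZMod 3 × ZMod 3) : Fin 4 → ZMod 3 := ![p.1, p.2, p.1 + p.2, p.1 - p.2]

/-- The set of words is the affine plane of order 3, up to the names of the parallel classes and
of the lines. -/
def IsAffinePlane (H : Set Word) : Prop :=
  ∃ (σ : Equiv.Perm (Fin 4)) (φ : Fin 4 → ZMod 3 → ℕ), (∀ i, Function.Injective (φ i)) ∧
    H = Set.range fun p i => φ i (lineCoord p (σ i))

/-! ### Invariance under permuting colors and renaming components -/

/-- Permute the coordinates of a word and rename the components of each color. -/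
def relabel (σ : Equiv.Perm (Fin 4)) (π : Fin 4 → Equiv.Perm ℕ) (w : Word) : Word :=
  fun i => π i (w (σ i))

theorem relabel_injective (σ : Equiv.Perm (Fin 4)) (π : Fin 4 → Equiv.Perm ℕ) :
    Function.Injective (relabel σ π) := by
  intro u w h
  funext j
  have := congrFun h (σ.symm j)
  simpa [relabel] using this

theorem agree_relabel (σ : Equiv.Perm (Fin 4)) (π : Fin 4 → Equiv.Perm ℕ) (u w : Word) :
    agree (relabel σ π u) (relabel σ π w) = agree u w := by
  unfold agree relabel
  simp only [EmbeddingLike.apply_eq_iff_eq]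
  exact Finset.card_equiv σ (by simp)

theorem HasSmallCover.of_relabel {σ : Equiv.Perm (Fin 4)} {π : Fin 4 → Equiv.Perm ℕ}
    {H : Set Word} (h : HasSmallCover (relabel σ π '' H)) : HasSmallCover H := by
  obtain ⟨S, t, hS, hc⟩ := h
  refine ⟨S.image fun x => (σ x.1, (π x.1).symm x.2), t, card_image_le.trans_lt hS,
    fun w hw => (hc _ ⟨w, hw, rfl⟩).trans ?_⟩
  refine card_le_card_of_injOn σ (fun i hi => ?_) σ.injective.injOn
  simp only [coe_filter, mem_univ, true_and, Set.mem_ofPred_eq, mem_image] at hi ⊢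
  exact ⟨_, hi, by simp [relabel]⟩

theorem IsAffinePlane.of_relabel {σ : Equiv.Perm (Fin 4)} {π : Fin 4 → Equiv.Perm ℕ}
    {H : Set Word} (h : IsAffinePlane (relabel σ π '' H)) : IsAffinePlane H := by
  obtain ⟨τ, φ, hφ, hH⟩ := h
  refine ⟨σ.symm.trans τ, fun j x => (π (σ.symm j)).symm (φ (σ.symm j) x),
    fun j => (π (σ.symm j)).symm.injective.comp (hφ _), ?_⟩
  ext w
  rw [← (relabel_injective σ π).mem_set_image, hH, Set.mem_range, Set.mem_range]
  refine exists_congr fun p => ⟨fun h => ?_, fun h => ?_⟩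
  · funext j
    have := congrFun h (σ.symm j)
    simp only [relabel, Equiv.apply_symm_apply] at this
    simp [this]
  · funext i
    have := congrFun h (σ i)
    simp only [Equiv.symm_apply_apply, Equiv.trans_apply] at this
    simp [relabel, ← this]

/-- Components whose names are at least `k i` can be renamed so that a given word uses, in
color `i`, no name above `k i`. -/
theorem exists_rename (k w : Word) : ∃ π : Fin 4 → Equiv.Perm ℕ,
    (∀ i x, x < k i → π i x = x) ∧ (∀ i, π i (w i) = min (w i) (k i)) ∧
    ∀ l : Word, l ≤ k → ∀ i x, min (π i x) (l i) = min x (l i) := by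
  -- A fresh name `w i ≥ k i` is swapped with `k i`; for an old name the swap is the identity.
  have hfix : ∀ i x, x < k i → Equiv.swap (w i) (min (w i) (k i)) x = x := by
    intro i x hx
    rcases le_total (w i) (k i) with h | h
    · simp [min_eq_left h]
    · rw [min_eq_right h, Equiv.swap_apply_of_ne_of_ne] <;> omega
  refine ⟨fun i => Equiv.swap (w i) (min (w i) (k i)), hfix, fun i => Equiv.swap_apply_left _ _,
    fun l hl i x => ?_⟩
  by_cases hx : x < k i
  · rw [hfix i x hx]
  · have hx' : k i ≤ Equiv.swap (w i) (min (w i) (k i)) x := by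
      by_contra! hlt
      have h := hfix i _ hlt
      rw [EmbeddingLike.apply_eq_iff_eq] at h
      omega
    have := hl i
    rw [min_eq_right (this.trans hx'), min_eq_right (this.trans (not_lt.1 hx))]

/-! ### Words in a form suited to kernel computation -/

/-- A quadruple of natural numbers, as a data structure on which the kernel computes fast. -/
structure Quad where
  (a b c d : ℕ)

namespace Quad

def word (q : Quad) : Word := ![q.a, q.b, q.c, q.d]

def beq (p q : Quad) : Bool := p.a.beq q.a && (p.b.beq q.b && (p.c.beq q.c && p.d.beq q.d))

def ble (p q : Quad) : Bool := p.a.ble q.a && (p.b.ble q.b && (p.c.ble q.c && p.d.ble q.d))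

def blt (p q : Quad) : Bool :=
  p.a.succ.ble q.a && (p.b.succ.ble q.b && (p.c.succ.ble q.c && p.d.succ.ble q.d))

def map₂ (f : ℕ → ℕ → ℕ) (p q : Quad) : Quad := ⟨f p.a q.a, f p.b q.b, f p.c q.c, f p.d q.d⟩

def agree (p q : Quad) : ℕ :=
  (bif p.a.beq q.a then 1 else 0) + ((bif p.b.beq q.b then 1 else 0) +
    ((bif p.c.beq q.c then 1 else 0) + bif p.d.beq q.d then 1 else 0))

theorem word_injective : Function.Injective word := by
  rintro ⟨a, b, c, d⟩ ⟨a', b', c', d'⟩ h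
  have h0 := congrFun h 0
  have h1 := congrFun h 1
  have h2 := congrFun h 2
  have h3 := congrFun h 3
  simp_all [word]

theorem exists_word_eq (w : Word) : ∃ q : Quad, q.word = w :=
  ⟨⟨w 0, w 1, w 2, w 3⟩, by funext i; fin_cases i <;> rfl⟩

theorem beq_iff {p q : Quad} : p.beq q = true ↔ p = q := by
  obtain ⟨a, b, c, d⟩ := p
  obtain ⟨a', b', c', d'⟩ := q
  simp [beq]

theorem ble_iff {p q : Quad} : p.ble q = true ↔ p.word ≤ q.word := by
  simp [ble, word, Pi.le_def, Fin.forall_fin_succ]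

theorem blt_iff {p q : Quad} : p.blt q = true ↔ ∀ i, p.word i < q.word i := by
  simp [blt, word, Fin.forall_fin_succ]

theorem word_map₂ (f : ℕ → ℕ → ℕ) (p q : Quad) (i : Fin 4) :
    (map₂ f p q).word i = f (p.word i) (q.word i) := by
  fin_cases i <;> rfl

theorem agree_eq (p q : Quad) : p.agree q = ColoredComponents.agree p.word q.word := by
  unfold ColoredComponents.agree
  rw [card_filter, Fin.sum_univ_four]
  simp [agree, word, Bool.cond_eq_ite, add_assoc]
  rfl

end Quad

/-- `f n` holds for all `n ≤ m`. -/
def allUpTo (f : ℕ → Bool) : ℕ → Bool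
  | 0 => f 0
  | m + 1 => f (m + 1) && allUpTo f m

theorem allUpTo_iff {f : ℕ → Bool} {m : ℕ} : allUpTo f m = true ↔ ∀ n ≤ m, f n = true := by
  induction m with
  | zero => simp [allUpTo]
  | succ m ih =>
    simp only [allUpTo, Bool.and_eq_true, ih, Nat.le_succ_iff]
    grind

/-- `f q` holds for all `q ≤ k`. -/
def Quad.allUpTo (f : Quad → Bool) (k : Quad) : Bool :=
  ColoredComponents.allUpTo (fun a => ColoredComponents.allUpTo (fun b =>
    ColoredComponents.allUpTo (fun c => ColoredComponents.allUpTo (fun d => f ⟨a, b, c, d⟩)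
      k.d) k.c) k.b) k.a

theorem Quad.allUpTo_iff {f : Quad → Bool} {k : Quad} :
    k.allUpTo f = true ↔ ∀ q : Quad, q.word ≤ k.word → f q = true := by
  simp only [Quad.allUpTo, ColoredComponents.allUpTo_iff]
  constructor
  · rintro h ⟨a, b, c, d⟩ hq
    exact h a (hq 0) b (hq 1) c (hq 2) d (hq 3)
  · intro h a ha b hb c hc d hd
    refine h ⟨a, b, c, d⟩ fun i => ?_
    fin_cases i
    exacts [ha, hb, hc, hd]

/-! ### Case trees and their checker -/

/-- A case analysis on the words that occur in a set: `split a b c d s t` distinguishes whether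
some word has the pattern `(a, b, c, d)`, and the leaves state how the set is handled. -/
inductive CaseTree
  | cover (t : ℕ) (A B C D : List ℕ)
  | affine
  | split (a b c d : ℕ) (s t : CaseTree)

/-- Could a word of pattern `p` belong to a set that contains the words `T`, avoids the patterns
in `E` and in which distinct words agree in at least one and at most `M` coordinates? -/
def admissible (M : ℕ) (T : List Quad) (E : List (Quad × Quad)) (p : Quad) : Bool :=
  T.all (fun u => Nat.ble 1 (u.agree p) && (Nat.ble (u.agree p) M || u.beq p)) &&
    E.all fun e => !(p.map₂ min e.2).beq e.1

/-- The words of the affine plane of order 3, for suitable names. -/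
def affineList : List Quad :=
  [⟨2, 2, 1, 0⟩, ⟨2, 1, 0, 2⟩, ⟨1, 2, 0, 1⟩, ⟨1, 1, 2, 0⟩, ⟨2, 0, 2, 1⟩, ⟨1, 0, 1, 2⟩,
    ⟨0, 2, 2, 2⟩, ⟨0, 1, 1, 1⟩, ⟨0, 0, 0, 0⟩]

/-- How often the word `p` is met by the components with names in `A`, `B`, `C`, `D`. -/
def coverCount (A B C D : List ℕ) (p : Quad) : ℕ :=
  (bif A.any p.a.beq then 1 else 0) + ((bif B.any p.b.beq then 1 else 0) +
    ((bif C.any p.c.beq then 1 else 0) + bif D.any p.d.beq then 1 else 0))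

/-- Verify a case analysis for sets that contain the words `T`, have used the names below `k` and
avoid the patterns in `E`. -/
def CaseTree.check (M : ℕ) : CaseTree → List Quad → Quad → List (Quad × Quad) → Bool
  | cover t A B C D, T, k, E =>
    Nat.blt (A.length + (B.length + (C.length + D.length))) (coverBound t) &&
    ((A.all (Nat.blt · k.a) && (B.all (Nat.blt · k.b) && (C.all (Nat.blt · k.c) &&
      D.all (Nat.blt · k.d)))) &&
    k.allUpTo fun p => !admissible M T E p || Nat.ble t (coverCount A B C D p))
  | affine, T, k, E =>
    (T.length.beq 9 && (T.zip affineList).all fun x => x.1.beq x.2) &&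
    -- A pattern is a word truncated at `k`, an entry `k i` standing for any fresh name; `p.blt k`
    -- says that nothing was truncated.
    k.allUpTo fun p => !admissible M T E p || (p.blt k && T.any p.beq)
  | split a b c d s t, T, k, E =>
    (Quad.mk a b c d).ble k &&
    -- Only a coordinate with a fresh name raises its threshold, and by one.
    (s.check M (⟨a, b, c, d⟩ :: T) ((Quad.mk a b c d).map₂ (fun x y => max (x + 1) y) k) E &&
    -- The thresholds grow later, so the excluded pattern is stored with those at which it was read.
    t.check M T k ((⟨a, b, c, d⟩, k) :: E))

/-- A list of old names does not contain `k`, so membership can be tested on the truncated name.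
Hence covers may use old names only. -/
theorem min_mem_list_iff {k x : ℕ} {l : List ℕ} (hl : ∀ y ∈ l, y < k) : min x k ∈ l ↔ x ∈ l := by
  rcases le_total x k with h | h
  · rw [min_eq_left h]
  · rw [min_eq_right h]
    constructor
    · intro hk
      exact absurd (hl k hk) (lt_irrefl k)
    · intro hx
      rwa [← (hl x hx).le.antisymm h]

/-- The components with names in the `i`-th of the lists `L`, for each color `i`. -/
def namedComponents (L : Fin 4 → List ℕ) : Finset (Fin 4 × ℕ) :=
  univ.biUnion fun i => (L i).toFinset.image (Prod.mk i)

theorem mem_namedComponents {L : Fin 4 → List ℕ} {i : Fin 4} {x : ℕ} :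
    (i, x) ∈ namedComponents L ↔ x ∈ L i := by
  simp only [namedComponents, mem_biUnion, mem_univ, true_and, mem_image, List.mem_toFinset,
    Prod.mk.injEq]
  grind

theorem card_namedComponents_le (L : Fin 4 → List ℕ) :
    #(namedComponents L) ≤ ∑ i, (L i).length :=
  card_biUnion_le.trans (sum_le_sum fun _ _ => card_image_le.trans (List.toFinset_card_le _))

theorem coverCount_eq (A B C D : List ℕ) (p : Quad) :
    coverCount A B C D p = #{i | (i, p.word i) ∈ namedComponents ![A, B, C, D]} := by
  have hany : ∀ (l : List ℕ) (x : ℕ), l.any x.beq = decide (x ∈ l) := by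
    intro l x
    rw [Bool.eq_iff_iff]
    simp
  rw [card_filter, Fin.sum_univ_four]
  simp only [mem_namedComponents, coverCount, hany, Bool.cond_decide, Quad.word]
  simp only [add_assoc]
  congr!

/-! ### Soundness of the checker -/

/-- The hypotheses on a set of words under which a case analysis is sound. -/
structure Describes (M : ℕ) (T : List Quad) (k : Quad) (E : List (Quad × Quad)) (H : Set Word) :
    Prop where
  inter : IsIntersecting H
  agree_le : ∀ u ∈ H, ∀ w ∈ H, u ≠ w → agree u w ≤ M
  mem : ∀ u ∈ T, u.word ∈ H
  lt : ∀ u ∈ T, ∀ i, u.word i < k.word i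
  le : ∀ e ∈ E, e.2.word ≤ k.word
  avoid : ∀ e ∈ E, ∀ w ∈ H, (fun i => min (w i) (e.2.word i)) ≠ e.1.word

/-- Known words use only names below `k`, so truncating `w` at `k` preserves its agreements with
them; earlier thresholds are at most `k`, so the excluded patterns are still recognized. -/
theorem Describes.admissible {M : ℕ} {T : List Quad} {k : Quad} {E : List (Quad × Quad)}
    {H : Set Word} (h : Describes M T k E H) {w : Word} (hw : w ∈ H) {p : Quad}
    (hp : ∀ i, p.word i = min (w i) (k.word i)) : admissible M T E p = true := by
  have hag : ∀ u ∈ T, u.agree p = agree u.word w := by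
    intro u hu
    rw [Quad.agree_eq]
    unfold agree
    congr 1
    ext i
    have := h.lt u hu i
    have := hp i
    simp only [mem_filter, mem_univ, true_and]
    omega
  simp only [ColoredComponents.admissible, Bool.and_eq_true, List.all_eq_true, Bool.or_eq_true,
    Nat.ble_eq, Bool.not_eq_true', Bool.eq_false_iff, ne_eq, Quad.beq_iff]
  refine ⟨fun u hu => ⟨?_, ?_⟩, fun e he heq => h.avoid e he w hw ?_⟩
  · rw [hag u hu]
    exact h.inter _ (h.mem u hu) _ hw
  · rw [hag u hu]
    by_cases huw : u.word = w
    · right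
      apply Quad.word_injective
      funext i
      rw [hp, ← huw, min_eq_left (h.lt u hu i).le]
    · exact Or.inl (h.agree_le _ (h.mem u hu) _ hw huw)
  · rw [← heq]
    funext i
    rw [Quad.word_map₂, hp, min_assoc, min_eq_right (h.le e he i)]

theorem IsIntersecting.relabel {H : Set Word} (h : IsIntersecting H) (σ : Equiv.Perm (Fin 4))
    (π : Fin 4 → Equiv.Perm ℕ) : IsIntersecting (relabel σ π '' H) := by
  rintro _ ⟨u, hu, rfl⟩ _ ⟨w, hw, rfl⟩
  rw [agree_relabel]
  exact h u hu w hw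

theorem agree_le_relabel {M : ℕ} {H : Set Word} (h : ∀ u ∈ H, ∀ w ∈ H, u ≠ w → agree u w ≤ M)
    (σ : Equiv.Perm (Fin 4)) (π : Fin 4 → Equiv.Perm ℕ) :
    ∀ u ∈ relabel σ π '' H, ∀ w ∈ relabel σ π '' H, u ≠ w → agree u w ≤ M := by
  rintro _ ⟨u, hu, rfl⟩ _ ⟨w, hw, rfl⟩ huw
  rw [agree_relabel]
  exact h u hu w hw fun e => huw (by rw [e])

/-- A word of the set can be renamed to its pattern, and then be added to the known words. -/
theorem Describes.exists_cons {M : ℕ} {T : List Quad} {k : Quad} {E : List (Quad × Quad)}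
    {H : Set Word} (h : Describes M T k E H) {w : Word} (hw : w ∈ H) {p : Quad}
    (hp : ∀ i, p.word i = min (w i) (k.word i)) :
    ∃ π, relabel (Equiv.refl _) π w = p.word ∧
      Describes M (p :: T) (p.map₂ (fun x y => max (x + 1) y) k) E
      (relabel (Equiv.refl _) π '' H) := by
  obtain ⟨π, hfix, hπ, hmin⟩ := exists_rename k.word w
  refine ⟨π, funext fun i => by simp [relabel, hπ, hp], h.inter.relabel _ _,
    agree_le_relabel h.agree_le _ _, ?_, ?_, ?_, ?_⟩
  · intro u hu
    rcases List.mem_cons.1 hu with rfl | hu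
    · exact ⟨w, hw, funext fun i => by simp [relabel, hπ, hp]⟩
    · exact ⟨u.word, h.mem u hu, funext fun i => by simp [relabel, hfix i _ (h.lt u hu i)]⟩
  · intro u hu i
    rw [Quad.word_map₂]
    rcases List.mem_cons.1 hu with rfl | hu
    · exact lt_max_of_lt_left (Nat.lt_succ_self _)
    · exact lt_max_of_lt_right (h.lt u hu i)
  · intro e he i
    rw [Quad.word_map₂]
    exact le_max_of_le_right (h.le e he i)
  · rintro e he _ ⟨u, hu, rfl⟩ heq
    refine h.avoid e he u hu ?_
    rw [← heq]
    funext i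
    simp [relabel, hmin _ (h.le e he)]

/-- The fourth entry of the list is `y - x`, whence the negation in the last naming. -/
theorem isAffinePlane_affineList : IsAffinePlane {w | ∃ q ∈ affineList, q.word = w} := by
  refine ⟨Equiv.refl _, ![ZMod.val, ZMod.val, ZMod.val, fun x => (-x).val], ?_, ?_⟩
  · have h : Function.Injective (ZMod.val : ZMod 3 → ℕ) := ZMod.val_injective 3
    intro i
    fin_cases i
    exacts [h, h, h, h.comp neg_injective]
  · have h₁ : ∀ q ∈ affineList, ∃ p : ZMod 3 × ZMod 3, (fun i => (![ZMod.val, ZMod.val, ZMod.val,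
        fun x => (-x).val] : Fin 4 → ZMod 3 → ℕ) i (lineCoord p i)) = q.word := by
      simp only [affineList, List.forall_mem_cons, List.not_mem_nil, false_imp_iff, implies_true,
        and_true]
      decide
    have h₂ : ∀ p : ZMod 3 × ZMod 3, ∃ q ∈ affineList, q.word = (fun i => (![ZMod.val, ZMod.val,
        ZMod.val, fun x => (-x).val] : Fin 4 → ZMod 3 → ℕ) i (lineCoord p i)) := by
      simp only [affineList, List.exists_mem_cons_iff, List.not_mem_nil, false_and, exists_false,
        or_false]
      decide
    ext w
    constructor
    · rintro ⟨q, hq, rfl⟩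
      exact h₁ q hq
    · rintro ⟨p, rfl⟩
      exact h₂ p

/-- At a split, either a word with the pattern exists and is renamed into the list of known words,
or the pattern joins the exclusions. Both conclusions pull back along relabelings. -/
theorem CaseTree.check_sound {M : ℕ} (s : CaseTree) : ∀ {T : List Quad} {k : Quad}
    {E : List (Quad × Quad)} {H : Set Word}, s.check M T k E = true → Describes M T k E H →
    HasSmallCover H ∨ IsAffinePlane H := by
  induction s with
  | cover t A B C D =>
    intro T k E H hs h
    simp only [check, Bool.and_eq_true, Nat.blt_eq, List.all_eq_true, Quad.allUpTo_iff,
      Bool.or_eq_true, Bool.not_eq_true', Nat.ble_eq] at hs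
    obtain ⟨hcard, ⟨hA, hB, hC, hD⟩, hcov⟩ := hs
    refine Or.inl ⟨namedComponents ![A, B, C, D], t,
      (card_namedComponents_le _).trans_lt ?_, fun w hw => ?_⟩
    · simpa [Fin.sum_univ_four, add_assoc] using hcard
    · obtain ⟨p, hp⟩ := Quad.exists_word_eq fun i => min (w i) (k.word i)
      have hp' : ∀ i, p.word i = min (w i) (k.word i) := fun i => congrFun hp i
      have hle : p.word ≤ k.word := fun i => (hp' i).trans_le (min_le_right _ _)
      have := hcov p hle
      rw [h.admissible hw hp', coverCount_eq] at this
      simp only [reduceCtorEq, false_or] at this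
      refine this.trans (card_le_card fun i hi => ?_)
      rw [mem_filter] at hi ⊢
      refine ⟨mem_univ _, ?_⟩
      rw [mem_namedComponents, hp', min_mem_list_iff] at hi
      · exact mem_namedComponents.2 hi.2
      · fin_cases i
        exacts [hA, hB, hC, hD]
  | affine =>
    intro T k E H hs h
    simp only [check, Bool.and_eq_true, Nat.beq_eq, List.all_eq_true, Quad.allUpTo_iff,
      Bool.or_eq_true, Bool.not_eq_true', Quad.beq_iff, List.any_eq_true] at hs
    obtain ⟨⟨hlen, hT⟩, hH⟩ := hs
    have hTeq : T = affineList := by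
      apply List.ext_getElem hlen
      intro i h₁ h₂
      exact hT (T[i], affineList[i]) (List.mem_iff_getElem.2 ⟨i, by simp [h₁, h₂], by simp⟩)
    have hHeq : H = {w | ∃ q ∈ affineList, q.word = w} := by
      ext w
      constructor
      · intro hw
        obtain ⟨p, hp⟩ := Quad.exists_word_eq fun i => min (w i) (k.word i)
        have hp' : ∀ i, p.word i = min (w i) (k.word i) := fun i => congrFun hp i
        have := hH p fun i => (hp' i).trans_le (min_le_right _ _)
        rw [h.admissible hw hp'] at this
        simp only [reduceCtorEq, false_or, Quad.blt_iff] at this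
        obtain ⟨hlt, q, hq, rfl⟩ := this
        refine ⟨p, hTeq ▸ hq, funext fun i => ?_⟩
        have := hlt i
        rw [hp'] at this ⊢
        omega
      · rintro ⟨q, hq, rfl⟩
        exact h.mem q (hTeq ▸ hq)
    rw [hHeq]
    exact Or.inr isAffinePlane_affineList
  | split a b c d s t ihs iht =>
    intro T k E H hs h
    simp only [check, Bool.and_eq_true, Quad.ble_iff] at hs
    obtain ⟨hle, hs, ht⟩ := hs
    by_cases hex : ∃ w ∈ H, ∀ i, (Quad.mk a b c d).word i = min (w i) (k.word i)
    · obtain ⟨w, hw, hp⟩ := hex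
      obtain ⟨π, -, hπ⟩ := h.exists_cons hw hp
      exact (ihs hs hπ).imp HasSmallCover.of_relabel IsAffinePlane.of_relabel
    · refine iht ht ⟨h.inter, h.agree_le, h.mem, h.lt, ?_, ?_⟩
      · intro e he
        rcases List.mem_cons.1 he with rfl | he
        · exact le_rfl
        · exact h.le e he
      · intro e he w hw heq
        rcases List.mem_cons.1 he with rfl | he
        · exact hex ⟨w, hw, fun i => (congrFun heq i).symm⟩
        · exact h.avoid e he w hw heq

/-! ### The three case analyses -/

/-- The case analysis for sets in which distinct words agree in at most one coordinate and two
of the words are `0000` and `0111`. -/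
def linearTree : CaseTree :=
  .split 0 2 2 2
    (.split 1 0 1 2
       (.split 2 0 2 1
          (.split 1 1 2 0
             (.split 1 2 0 1
                (.split 2 1 0 2
                   (.split 2 2 1 0 .affine <|
                    .cover 3 [0, 1] [0, 1] [0, 2] [1, 2]) <|
                 .cover 3 [0, 1] [0, 2] [1, 2] [0, 1]) <|
              .cover 3 [0, 2] [0, 1] [1, 2] [0, 2]) <|
           .cover 3 [0, 2] [0, 2] [0, 1] [1, 2]) <|
        .cover 3 [0, 1] [1, 2] [0, 1] [0, 2]) <|
     .split 0 3 3 3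
       (.cover 1 [0] [] [] []) <|
     .split 1 1 0 2
       (.cover 3 [0, 1] [1, 2] [0, 2] [0, 1]) <|
     .cover 2 [0] [2] [2] [0, 1]) <|
  .split 1 0 1 2
    (.split 2 0 2 1
       (.cover 3 [1, 2] [0, 1] [0, 1] [0, 1]) <|
     .cover 2 [1] [1] [0, 1] [0]) <|
  .split 1 0 2 1
    (.cover 2 [1] [1] [0] [0, 1]) <|
  .cover 2 [] [1] [0, 1] [0, 1]

/-- The case analysis for sets in which distinct words agree in at most two coordinates and two
of the words are `0000` and `0011`. -/
def doubleTree : CaseTree :=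
  .split 1 1 1 0
    (.split 2 1 0 1
       (.split 1 2 0 1
          (.split 2 2 1 0
             (.cover 2 [0] [1, 2] [0, 1] []) <|
           .cover 2 [] [0, 1] [0] [0, 1]) <|
        .split 2 2 1 0
          (.cover 2 [] [0, 1] [1] [0, 1]) <|
        .cover 2 [0, 1, 2] [0, 1] [] []) <|
     .split 1 2 0 1
       (.split 2 2 1 0
          (.cover 2 [] [0, 2] [0, 1] [0]) <|
        .cover 2 [0, 1] [0, 1, 2] [] []) <|
     .split 2 0 1 2
       (.split 0 1 0 2
          (.cover 2 [0, 1] [] [0, 1] [2]) <|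
        .split 0 1 2 2
          (.cover 2 [0, 1] [0] [1, 2] []) <|
        .cover 2 [0, 1] [0] [1] [0]) <|
     .split 2 2 1 0
       (.cover 2 [0, 1] [0] [1] [0]) <|
     .split 0 2 1 2
       (.split 1 0 1 3
          (.cover 2 [0] [0, 1] [1] [2]) <|
        .split 0 3 1 3
          (.cover 2 [0] [0, 1] [1] [0]) <|
        .cover 2 [0] [0, 1] [] [0, 2]) <|
     .cover 2 [0, 1] [0, 1] [] [0]) <|
  .split 0 1 2 2
    (.split 1 1 0 1
       (.split 0 2 0 3
          (.split 1 0 2 3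
             (.cover 2 [0] [0, 1] [0, 2] []) <|
           .cover 2 [0] [1] [0] [1, 2]) <|
        .split 1 0 2 0
          (.split 2 0 0 2
             (.cover 2 [] [0] [0, 2] [1, 2]) <|
           .cover 2 [0, 1] [0, 1] [] [1]) <|
        .split 1 0 2 3
          (.split 2 0 0 2
             (.cover 2 [0, 1] [0] [0, 2] []) <|
           .cover 2 [0, 1] [0, 1] [] [1]) <|
        .cover 2 [0] [0, 1] [] [1, 2]) <|
     .split 1 0 2 2
       (.cover 2 [0] [0] [2] [1, 2]) <|
     .split 1 0 1 2
       (.cover 2 [0] [0] [1, 2] [2]) <|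
     .split 1 0 0 2
       (.cover 2 [0] [0] [0, 2] [2]) <|
     .split 1 0 2 0
       (.cover 2 [0] [0] [2] [0, 2]) <|
     .split 1 0 2 1
       (.cover 2 [0] [0] [2] [1, 2]) <|
     .split 1 0 3 2
       (.cover 2 [0] [0] [2, 3] [2]) <|
     .split 1 0 2 3
       (.cover 2 [0] [0] [2] [2, 3]) <|
     .cover 1 [0] [] [] []) <|
  .split 1 0 2 2
    (.split 0 1 1 2
       (.split 1 1 0 1
          (.split 2 0 0 2
             (.cover 2 [0, 1] [0] [0] [2]) <|
           .cover 2 [0, 1] [] [0, 1, 2] []) <|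
        .cover 2 [0] [0] [1, 2] [2]) <|
     .split 1 1 0 1
       (.split 0 1 2 0
          (.cover 2 [0, 1] [0] [0, 2] []) <|
        .cover 2 [0, 1] [0] [0] [1]) <|
     .split 0 1 2 0
       (.cover 2 [0] [0] [2] [0, 2]) <|
     .split 0 1 2 1
       (.cover 2 [0] [0] [2] [1, 2]) <|
     .split 0 1 0 2
       (.cover 2 [0] [0] [0, 1] [2]) <|
     .cover 1 [] [0] [] []) <|
  .split 1 0 1 2
    (.split 2 0 2 1
       (.split 1 1 0 1
          (.cover 2 [1] [0] [0] [1, 2]) <|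
        .cover 1 [] [0] [] []) <|
     .split 2 0 2 0
       (.split 0 1 1 0
          (.cover 2 [0] [0] [1] [0, 2]) <|
        .cover 1 [] [0] [] []) <|
     .cover 2 [0, 1] [0] [0, 1] []) <|
  .split 0 1 1 2
    (.split 0 2 1 3
       (.split 1 0 1 0
          (.cover 2 [0] [0] [1] [0, 2]) <|
        .cover 1 [0] [] [] []) <|
     .split 0 2 2 1
       (.split 1 1 0 1
          (.cover 2 [0] [] [0, 1] [0, 1]) <|
        .cover 1 [0] [] [] []) <|
     .cover 2 [0] [0, 1] [0] [0]) <|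
  .cover 2 [0] [0] [0] [0, 1]

/-- The case analysis for sets of words two of which are `0000` and `0001`. -/
def tripleTree : CaseTree :=
  .split 1 1 0 2
    (.split 2 2 0 0
       (.split 2 0 1 2
          (.split 0 1 1 0
             (.split 2 1 0 1
                (.cover 2 [0, 2] [0, 1] [0] []) <|
              .split 2 1 0 3
                (.cover 2 [0, 2] [0, 1] [0] []) <|
              .cover 2 [0] [0] [0] [0, 2]) <|
           .split 0 2 1 2
             (.cover 2 [] [0, 2] [0, 1] [2]) <|
           .split 0 2 2 2
             (.cover 2 [1] [0, 2] [0] [2]) <|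
           .cover 2 [2] [0] [0] [0, 2]) <|
        .split 1 0 1 0
          (.split 0 2 1 2
             (.cover 3 [0, 1] [0, 1, 2] [0] [0, 2]) <|
           .cover 2 [1] [0, 1] [0] [0]) <|
        .split 0 1 1 0
          (.cover 2 [0] [1, 2] [0] [0]) <|
        .split 0 2 1 2
          (.cover 2 [0, 2] [2] [0] [2]) <|
        .cover 1 [] [] [0] []) <|
     .split 2 2 0 3
       (.split 1 0 1 3
          (.split 0 1 1 3
             (.split 0 2 1 2
                (.cover 2 [0] [] [0, 1] [2, 3]) <|
              .cover 2 [] [0, 1] [0] [2, 3]) <|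
           .split 0 2 1 2
             (.split 0 1 2 3
                (.cover 2 [0] [0] [0] [2, 3]) <|
              .cover 2 [] [0, 2] [0] [2, 3]) <|
           .split 0 1 2 3
             (.cover 2 [] [0, 1] [0] [2, 3]) <|
           .cover 2 [1] [0] [0] [2, 3]) <|
        .split 2 0 1 2
          (.split 0 1 1 3
             (.cover 2 [0, 2] [] [0] [2, 3]) <|
           .cover 2 [2] [0, 2] [0] [2]) <|
        .split 0 1 1 3
          (.cover 2 [0] [1] [0] [2, 3]) <|
        .split 0 2 1 2
          (.cover 2 [0] [0, 2] [0] [2]) <|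
        .cover 1 [] [] [0] []) <|
     .split 2 0 1 2
       (.split 0 2 2 2
          (.split 0 1 1 3
             (.cover 2 [0, 1] [0, 1] [] [2]) <|
           .split 1 0 2 0
             (.cover 2 [0, 1] [0, 1] [] [2]) <|
           .split 0 1 1 0
             (.cover 2 [0] [] [0, 1] [1, 2]) <|
           .split 1 0 2 3
             (.cover 2 [0, 1] [0] [] [2, 3]) <|
           .cover 2 [0] [0] [0] [1, 2]) <|
        .split 2 2 0 1
          (.split 0 2 1 2
             (.cover 2 [] [0] [0, 1] [1, 2]) <|
           .cover 2 [] [0, 1] [0] [1, 2]) <|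
        .split 1 0 2 0
          (.split 0 1 1 0
             (.cover 3 [0, 1] [0, 1] [0, 1] [0, 2]) <|
           .cover 2 [1] [0, 1] [0] [2]) <|
        .split 1 0 2 3
          (.split 0 1 1 3
             (.cover 3 [0, 1] [0, 1] [0, 1] [2, 3]) <|
           .cover 2 [1] [0, 1] [0] [2]) <|
        .split 1 0 2 1
          (.split 0 1 2 2
             (.cover 2 [] [0, 1] [0] [1, 2]) <|
           .cover 2 [] [0] [0, 1] [1, 2]) <|
        .cover 2 [] [0, 1] [0, 1] [2]) <|
     .split 0 2 1 2
       (.split 0 1 2 1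
          (.split 1 0 2 2
             (.split 1 2 0 1
                (.cover 2 [0, 1] [] [0] [1, 2]) <|
              .cover 2 [0] [0, 1] [] [1, 2]) <|
           .split 1 0 1 1
             (.cover 3 [0] [0, 1, 2] [0, 1] [1, 2]) <|
           .cover 2 [0] [1] [0] [1, 2]) <|
        .split 0 1 2 3
          (.split 1 0 1 3
             (.cover 3 [0, 1] [0, 1] [0, 1] [2, 3]) <|
           .cover 2 [0, 1] [1] [0] [2]) <|
        .split 2 2 0 1
          (.cover 2 [0, 1] [] [0] [1, 2]) <|
        .split 0 1 2 0
          (.split 1 0 2 2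
             (.cover 2 [0] [0] [0] [0, 2]) <|
           .cover 2 [0] [] [0, 1] [0, 2]) <|
        .cover 2 [0, 1] [] [0, 1] [2]) <|
     .split 2 2 0 1
       (.split 1 0 1 1
          (.cover 2 [1] [0, 1] [0] [1]) <|
        .split 0 1 1 1
          (.cover 2 [0] [0, 1] [0] [1]) <|
        .cover 1 [] [] [0] []) <|
     .split 2 2 0 2
       (.split 0 0 1 2
          (.cover 2 [0] [0] [0] [0, 2]) <|
        .split 0 1 1 2
          (.cover 2 [0, 1] [1] [0] [2]) <|
        .split 1 0 1 2
          (.cover 2 [1] [0, 2] [0] [2]) <|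
        .cover 1 [] [] [0] []) <|
     .cover 2 [0, 1] [0, 1] [0] []) <|
  .split 0 1 1 2
    (.split 1 1 0 1
       (.split 0 2 2 1
          (.split 1 0 2 2
             (.cover 2 [0] [0, 1] [] [1, 2]) <|
           .cover 2 [0] [1] [0, 1] [1]) <|
        .split 1 0 2 2
          (.split 2 0 1 1
             (.cover 2 [0, 1] [0] [] [1, 2]) <|
           .cover 2 [0, 1] [0, 1] [] [2]) <|
        .cover 2 [0] [0, 1] [0, 1] []) <|
     .split 1 1 0 0
       (.split 0 2 2 0
          (.split 1 0 2 2
             (.cover 2 [0] [0, 1] [] [0, 2]) <|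
           .cover 2 [0] [1] [0, 1] [0]) <|
        .split 1 0 2 2
          (.split 2 0 1 0
             (.cover 2 [0, 1] [0] [] [0, 2]) <|
           .cover 2 [0, 1] [0, 1] [] [2]) <|
        .cover 2 [0] [0, 1] [0, 1] []) <|
     .split 1 0 1 1
       (.cover 2 [0] [0] [1] [1, 2]) <|
     .split 1 0 1 3
       (.cover 2 [0] [0] [1] [2, 3]) <|
     .split 1 0 0 2
       (.cover 2 [0] [0] [0, 1] [2]) <|
     .split 1 0 1 2
       (.cover 2 [0] [0] [1] [0, 2]) <|
     .split 1 0 1 0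
       (.cover 2 [0] [0] [1] [0, 2]) <|
     .split 1 0 2 2
       (.cover 2 [0] [0] [2] [1, 2]) <|
     .cover 1 [0] [] [] []) <|
  .split 1 0 1 2
    (.split 0 1 1 0
       (.split 1 1 0 1
          (.cover 2 [0, 1] [0] [0, 1] []) <|
        .cover 2 [0] [0] [0, 1] [0]) <|
     .split 1 1 0 0
       (.split 0 1 1 1
          (.cover 2 [0, 1] [0] [0, 1] []) <|
        .cover 2 [1] [0] [0] [0, 2]) <|
     .split 1 1 0 1
       (.cover 2 [0, 1] [0] [0] [1]) <|
     .split 0 1 1 1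
       (.cover 2 [0] [0] [0, 1] [1]) <|
     .split 0 1 0 2
       (.cover 2 [0] [0] [0] [0, 2]) <|
     .cover 1 [] [0] [] []) <|
  .cover 2 [0] [0] [0] [0, 1]

theorem check_linearTree : linearTree.check 1 [⟨0, 1, 1, 1⟩, ⟨0, 0, 0, 0⟩] ⟨1, 2, 2, 2⟩ []
      = true := by
  decide +kernel

theorem check_doubleTree : doubleTree.check 2 [⟨0, 0, 1, 1⟩, ⟨0, 0, 0, 0⟩] ⟨1, 1, 2, 2⟩ []
      = true := by
  decide +kernel

theorem check_tripleTree : tripleTree.check 3 [⟨0, 0, 0, 1⟩, ⟨0, 0, 0, 0⟩] ⟨1, 1, 1, 2⟩ []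
      = true := by
  decide +kernel

/-- Moves the coordinates in which two words agree to the front, so that the second word becomes
`0111`, `0011` or `0001`. -/
theorem exists_perm_lt_card : ∀ b : Fin 4 → Bool,
    ∃ σ : Equiv.Perm (Fin 4), ∀ i, b (σ i) = decide (i.val < #{j | b j = true}) := by
  decide +kernel

/-- A case analysis that starts from two words with the largest possible agreement. -/
theorem hasSmallCover_or_isAffinePlane_of_check {s : CaseTree} {p : Quad} {H : Set Word}
    (h : IsIntersecting H) {u w : Word} (hu : u ∈ H) (hw : w ∈ H)
    (hmax : ∀ x ∈ H, ∀ y ∈ H, x ≠ y → agree x y ≤ agree u w)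
    (hp : ∀ i : Fin 4, p.word i = if i.val < agree u w then 0 else 1)
    (hs : s.check (agree u w) [p, ⟨0, 0, 0, 0⟩] (p.map₂ (fun x y => max (x + 1) y) ⟨1, 1, 1, 1⟩) []
      = true) : HasSmallCover H ∨ IsAffinePlane H := by
  obtain ⟨σ, hσ⟩ := exists_perm_lt_card fun j => decide (u j = w j)
  simp only [decide_eq_true_eq, decide_eq_decide] at hσ
  suffices HasSmallCover (relabel σ (fun _ => Equiv.refl _) '' H) ∨
      IsAffinePlane (relabel σ (fun _ => Equiv.refl _) '' H) from
    this.imp HasSmallCover.of_relabel IsAffinePlane.of_relabel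
  -- With all thresholds 0 every word has the pattern `0000`, so `u` can be renamed to it.
  have h₀ : Describes (agree u w) [] ⟨0, 0, 0, 0⟩ [] (relabel σ (fun _ => Equiv.refl _) '' H) :=
    ⟨h.relabel _ _, agree_le_relabel hmax _ _, by simp, by simp, by simp, by simp⟩
  obtain ⟨π, hπ, h₁⟩ := h₀.exists_cons ⟨u, hu, rfl⟩ (p := ⟨0, 0, 0, 0⟩) (fun i => by
    fin_cases i <;> simp [Quad.word])
  suffices HasSmallCover (relabel (Equiv.refl _) π '' (relabel σ (fun _ => Equiv.refl _) '' H)) ∨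
      IsAffinePlane (relabel (Equiv.refl _) π '' (relabel σ (fun _ => Equiv.refl _) '' H)) from
    this.imp HasSmallCover.of_relabel IsAffinePlane.of_relabel
  obtain ⟨π', -, h₂⟩ := h₁.exists_cons ⟨_, ⟨w, hw, rfl⟩, rfl⟩ (p := p) (fun i => by
    have h0 : (Quad.mk 0 0 0 0).word i = 0 := by fin_cases i <;> rfl
    have h1 := congrFun hπ i
    rw [h0] at h1
    simp only [relabel, Equiv.refl_apply] at h1
    have hiff : u (σ i) = w (σ i) ↔ i.val < agree u w := hσ i
    rw [Quad.word_map₂, h0, hp]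
    simp only [relabel, Equiv.refl_apply]
    by_cases he : u (σ i) = w (σ i)
    · rw [if_pos (hiff.1 he), ← he, h1]
      simp
    · rw [if_neg (he ∘ hiff.2)]
      have : π i (w (σ i)) ≠ 0 := by
        rw [← h1]
        exact fun e => he ((π i).injective e).symm
      omega)
  exact (s.check_sound hs h₂).imp HasSmallCover.of_relabel IsAffinePlane.of_relabel

theorem agree_lt_four {u w : Word} (h : u ≠ w) : agree u w < 4 := by
  obtain ⟨i, hi⟩ := Function.ne_iff.1 h
  have := card_lt_card
    ((filter_ssubset (s := univ) (p := fun i => u i = w i)).2 ⟨i, mem_univ i, hi⟩)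
  simpa [agree] using this

/-- An intersecting set of words has a small cover or is an affine plane of order 3. -/
theorem IsIntersecting.hasSmallCover_or_isAffinePlane {H : Set Word} (h : IsIntersecting H) :
    HasSmallCover H ∨ IsAffinePlane H := by
  by_cases h₃ : ∃ u ∈ H, ∃ w ∈ H, u ≠ w ∧ agree u w = 3
  · obtain ⟨u, hu, w, hw, -, huw⟩ := h₃
    refine hasSmallCover_or_isAffinePlane_of_check (s := tripleTree) (p := ⟨0, 0, 0, 1⟩) h hu hw
      (fun x hx y hy hxy => ?_) (fun i => ?_) ?_
    · have := agree_lt_four hxy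
      omega
    · rw [huw]
      fin_cases i <;> rfl
    · rw [huw]
      exact check_tripleTree
  by_cases h₂ : ∃ u ∈ H, ∃ w ∈ H, u ≠ w ∧ agree u w = 2
  · obtain ⟨u, hu, w, hw, -, huw⟩ := h₂
    refine hasSmallCover_or_isAffinePlane_of_check (s := doubleTree) (p := ⟨0, 0, 1, 1⟩) h hu hw
      (fun x hx y hy hxy => ?_) (fun i => ?_) ?_
    · have := agree_lt_four hxy
      have : agree x y ≠ 3 := fun e => h₃ ⟨x, hx, y, hy, hxy, e⟩
      omega
    · rw [huw]
      fin_cases i <;> rfl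
    · rw [huw]
      exact check_doubleTree
  by_cases h₁ : ∃ u ∈ H, ∃ w ∈ H, u ≠ w
  · obtain ⟨u, hu, w, hw, huw⟩ := h₁
    have hone : ∀ x ∈ H, ∀ y ∈ H, x ≠ y → agree x y = 1 := by
      intro x hx y hy hxy
      have := agree_lt_four hxy
      have := h x hx y hy
      have : agree x y ≠ 3 := fun e => h₃ ⟨x, hx, y, hy, hxy, e⟩
      have : agree x y ≠ 2 := fun e => h₂ ⟨x, hx, y, hy, hxy, e⟩
      omega
    refine hasSmallCover_or_isAffinePlane_of_check (s := linearTree) (p := ⟨0, 1, 1, 1⟩) h hu hw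
      (fun x hx y hy hxy => ?_) (fun i => ?_) ?_
    · rw [hone x hx y hy hxy, hone u hu w hw huw]
    · rw [hone u hu w hw huw]
      fin_cases i <;> rfl
    · rw [hone u hu w hw huw]
      exact check_linearTree
  · push Not at h₁
    left
    rcases H.eq_empty_or_nonempty with rfl | ⟨u, hu⟩
    · exact ⟨∅, 1, by simp [coverBound], by simp⟩
    · refine ⟨{(0, u 0)}, 1, by simp [coverBound], fun w hw => ?_⟩
      rw [← h₁ u hu w hw]
      exact card_pos.2 ⟨0, by simp⟩

/-! ### Orders and edge numbers of components -/

namespace MonoComponent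

variable {V K : Type*} {c : TopEdgeLabeling V K}

/-- The number of vertices of a monochromatic component. -/
noncomputable def order (C : MonoComponent c) : ℕ := C.verts.ncard

theorem mem_verts {C : MonoComponent c} {v : V} :
    v ∈ C.verts ↔ (c.labelGraph C.1).connectedComponentMk v = C.2 :=
  Iff.rfl

theorem eq_of_mem_verts {C D : MonoComponent c} {v : V} (hC : v ∈ C.verts) (hD : v ∈ D.verts)
    (h : C.1 = D.1) : C = D := by
  obtain ⟨k, C⟩ := C
  obtain ⟨l, D⟩ := D
  obtain rfl : k = l := h
  rw [mem_verts] at hC hD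
  simp only at hC hD
  rw [← hC, ← hD]

theorem numEdges_le_choose [Finite V] (C : MonoComponent c) : C.numEdges ≤ C.order.choose 2 := by
  classical
  have := Fintype.ofFinite V
  have h := card_edgeFinset_le_card_choose_two (G := C.2.toSimpleGraph)
  rw [numEdges, order, Set.ncard_eq_toFinset_card', Set.ncard_eq_toFinset_card',
    Set.toFinset_card C.verts]
  convert h
  · ext e
    simp
  · rfl

end MonoComponent

instance {V K : Type*} [Finite V] [Finite K] (c : TopEdgeLabeling V K) :
    Finite (MonoComponent c) :=
  inferInstanceAs (Finite (Σ k : K, (c.labelGraph k).ConnectedComponent))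

instance {V K : Type*} [Nonempty V] [Nonempty K] (c : TopEdgeLabeling V K) :
    Nonempty (MonoComponent c) :=
  ⟨⟨Classical.arbitrary K, connectedComponentMk _ (Classical.arbitrary V)⟩⟩

/-- Every edge of the complete graph lies in a monochromatic component. -/
theorem choose_two_le_sum_numEdges {V K : Type*} [Fintype V] (c : TopEdgeLabeling V K)
    [Fintype (MonoComponent c)] :
    (Fintype.card V).choose 2 ≤ ∑ C : MonoComponent c, C.numEdges := by
  classical
  have hsub : (⊤ : SimpleGraph V).edgeFinset ⊆ univ.biUnion fun C : MonoComponent c =>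
      C.2.toSimpleGraph.edgeSet.toFinset.image (Sym2.map Subtype.val) := by
    intro e he
    induction e using Sym2.inductionOn with
    | hf x y =>
      rw [mem_edgeFinset, mem_edgeSet] at he
      have hadj : (c.labelGraph (c.get x y he)).Adj x y :=
        (TopEdgeLabeling.labelGraph_adj x y).2 ⟨he, rfl⟩
      simp only [mem_biUnion, mem_univ, true_and, mem_image, Set.mem_toFinset]
      refine ⟨⟨_, (c.labelGraph (c.get x y he)).connectedComponentMk x⟩,
        s(⟨x, ConnectedComponent.connectedComponentMk_mem⟩,
          ⟨y, ConnectedComponent.sound hadj.symm.reachable⟩), ?_, rfl⟩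
      rw [mem_edgeSet]
      exact (ConnectedComponent.toSimpleGraph_adj _ _ _).2 hadj
  rw [← card_edgeFinset_top_eq_card_choose_two]
  refine (card_le_card hsub).trans (card_biUnion_le.trans (sum_le_sum fun C _ => ?_))
  rw [MonoComponent.numEdges, Set.ncard_eq_toFinset_card']
  exact card_image_le

/-- The word of a vertex lists the names of the monochromatic components that contain it. -/
def wordOf {V : Type*} (c : TopEdgeLabeling V (Fin 4))
    (ι : ∀ k, (c.labelGraph k).ConnectedComponent → ℕ) (v : V) : Word :=
  fun i => ι i ((c.labelGraph i).connectedComponentMk v)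

theorem isIntersecting_range_wordOf {V : Type*} (c : TopEdgeLabeling V (Fin 4))
    (ι : ∀ k, (c.labelGraph k).ConnectedComponent → ℕ) :
    IsIntersecting (Set.range (wordOf c ι)) := by
  rintro _ ⟨u, rfl⟩ _ ⟨w, rfl⟩
  suffices ∃ i, wordOf c ι u i = wordOf c ι w i by
    obtain ⟨i, hi⟩ := this
    exact card_pos.2 ⟨i, by simp [hi]⟩
  by_cases huw : u = w
  · exact ⟨0, by rw [huw]⟩
  · have hadj : (c.labelGraph (c.get u w huw)).Adj u w :=
      (TopEdgeLabeling.labelGraph_adj u w).2 ⟨huw, rfl⟩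
    exact ⟨c.get u w huw, congrArg _ (ConnectedComponent.sound hadj.reachable)⟩

/-- If the components in `S` meet every vertex at least `t` times, then the remaining ones meet
every vertex at most `4 - t` times. -/
theorem sum_order_add_le {V : Type*} [Fintype V] (c : TopEdgeLabeling V (Fin 4))
    [Fintype (MonoComponent c)] (S : Finset (MonoComponent c)) [DecidableEq (MonoComponent c)]
    (t : ℕ) (hS : ∀ v, t ≤ #{i | (⟨i, (c.labelGraph i).connectedComponentMk v⟩ :
      MonoComponent c) ∈ S}) :
    ∑ C ∈ Sᶜ, C.order + t * Fintype.card V ≤ 4 * Fintype.card V := by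
  classical
  have horder : ∀ C : MonoComponent c, C.order = ∑ v, if v ∈ C.verts then 1 else 0 := by
    intro C
    rw [MonoComponent.order, Set.ncard_eq_toFinset_card', ← card_filter]
    congr 1
    ext v
    simp
  have hv : ∀ v, (∑ C ∈ Sᶜ, if v ∈ C.verts then 1 else 0) + t ≤ 4 := by
    intro v
    rw [← card_filter]
    -- A vertex lies in one component per color, so those outside `S` that contain `v` inject into
    -- the colors in which `S` misses `v`.
    have hle : #{C ∈ Sᶜ | v ∈ C.verts} ≤ #{i | ¬ (⟨i, (c.labelGraph i).connectedComponentMk v⟩ :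
        MonoComponent c) ∈ S} := by
      refine card_le_card_of_injOn (fun C => C.1) (fun C hC => ?_) fun C hC D hD h => ?_
      · simp only [coe_filter, mem_compl, Set.mem_ofPred_eq, mem_univ, true_and] at hC ⊢
        rw [MonoComponent.mem_verts.1 hC.2]
        exact hC.1
      · simp only [coe_filter, mem_compl, Set.mem_ofPred_eq] at hC hD
        exact MonoComponent.eq_of_mem_verts hC.2 hD.2 h
    have hadd := card_filter_add_card_filter_not (s := (univ : Finset (Fin 4))) fun i =>
      (⟨i, (c.labelGraph i).connectedComponentMk v⟩ : MonoComponent c) ∈ S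
    have := hS v
    rw [card_univ, Fintype.card_fin] at hadd
    omega
  simp only [horder]
  rw [sum_comm]
  calc _ = ∑ v : V, ((∑ C ∈ Sᶜ, if v ∈ C.verts then 1 else 0) + t) := by
        rw [sum_add_distrib, sum_const, card_univ, smul_eq_mul, mul_comm t]
    _ ≤ ∑ _v : V, 4 := sum_le_sum fun v _ => hv v
    _ = _ := by rw [sum_const, card_univ, smul_eq_mul, mul_comm]

/-! ### Edge counting with a small cover -/

/-- Since `ρ = 1 + √6` satisfies `ρ² = 2 ρ + 5`, the case `t = 2`, `k = 5` is an equality and fixes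
the constant; the other values of `coverBound` are the largest that this `ρ` allows. -/
theorem coverBound_weight {k t : ℕ} (h : k < coverBound t) :
    1 ≤ t ∧ (k : ℝ) + (4 - t) * (1 + √6) ≤ (1 + √6) ^ 2 := by
  have h6 : √6 ^ 2 = 6 := Real.sq_sqrt (by norm_num)
  have h2 : (2.449 : ℝ) < √6 := by
    rw [Real.lt_sqrt (by norm_num)]
    norm_num
  unfold coverBound at h
  split at h
  · have : (k : ℝ) ≤ 1 := by exact_mod_cast Nat.lt_succ_iff.1 h
    exact ⟨by norm_num, by push_cast; nlinarith⟩
  · have : (k : ℝ) ≤ 5 := by exact_mod_cast Nat.lt_succ_iff.1 h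
    exact ⟨by norm_num, by push_cast; nlinarith⟩
  · have : (k : ℝ) ≤ 8 := by exact_mod_cast Nat.lt_succ_iff.1 h
    exact ⟨by norm_num, by push_cast; nlinarith⟩
  · have : (k : ℝ) ≤ 11 := by exact_mod_cast Nat.lt_succ_iff.1 h
    exact ⟨by norm_num, by push_cast; nlinarith⟩
  · omega

/-- A small cover forces a component with many edges. -/
theorem exists_numEdges_ge_of_hasSmallCover {V : Type*} [Fintype V] [Nonempty V]
    (c : TopEdgeLabeling V (Fin 4)) (ι : ∀ k, (c.labelGraph k).ConnectedComponent → ℕ)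
    (hι : ∀ k, Function.Injective (ι k)) (h : HasSmallCover (Set.range (wordOf c ι))) :
    ∃ C : MonoComponent c,
      (2 / (14 + √96) : ℝ) * ((Fintype.card V).choose 2 : ℝ) ≤ (C.numEdges : ℝ) := by
  classical
  have := Fintype.ofFinite (MonoComponent c)
  obtain ⟨S₀, t, hcard, hcov⟩ := h
  obtain ⟨ht, hweight⟩ := coverBound_weight hcard
  set ρ : ℝ := 1 + √6 with hρ
  have h6 : √6 ^ 2 = 6 := Real.sq_sqrt (by norm_num)
  have hρ1 : 1 ≤ ρ := by rw [hρ]; linarith [Real.sqrt_nonneg 6]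
  have h96 : 14 + √96 = 2 * ρ ^ 2 := by
    have : √96 = 4 * √6 := by
      rw [show (96 : ℝ) = 4 ^ 2 * 6 by norm_num, Real.sqrt_mul (by norm_num),
        Real.sqrt_sq (by norm_num)]
    rw [this, hρ]
    linear_combination -2 * h6
  set n := Fintype.card V with hn
  set B : ℝ := 2 / (14 + √96) * (n.choose 2 : ℝ) with hB
  by_contra! hlt
  have hB2 : 2 * B * ρ ^ 2 = n * (n - 1) := by
    rw [hB, h96, Nat.cast_choose_two]
    field_simp
  have hB0 : 0 < B := (Nat.cast_nonneg _).trans_lt (hlt (Classical.arbitrary _))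
  have hn1 : (1 : ℝ) ≤ n := by exact_mod_cast Fintype.card_pos
  -- `s` is the order of a complete graph with `B` edges
  obtain ⟨s, hs1, hs⟩ : ∃ s : ℝ, 1 ≤ s ∧ s * (s - 1) = 2 * B := by
    have hsq : √(1 + 8 * B) ^ 2 = 1 + 8 * B := Real.sq_sqrt (by linarith)
    have h1 : 1 ≤ √(1 + 8 * B) := by
      rw [Real.one_le_sqrt]
      linarith
    exact ⟨(1 + √(1 + 8 * B)) / 2, by linarith, by linear_combination hsq / 4⟩
  -- Otherwise `s ρ > n - 1 + ρ ≥ n`, and `s (s - 1) ρ²` would exceed `n (n - 1)`, to which it is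
  -- equal.
  have hsn : (s - 1) * ρ ≤ n - 1 := by
    by_contra! hgt
    have hsρ : (n : ℝ) ≤ s * ρ := by linarith [mul_comm s ρ, sub_mul s 1 ρ]
    have : (n : ℝ) * (n - 1) < (s * ρ) * ((s - 1) * ρ) := by
      have h1 : (n : ℝ) * (n - 1) < n * ((s - 1) * ρ) := by
        apply mul_lt_mul_of_pos_left hgt
        linarith
      refine h1.trans_le (mul_le_mul_of_nonneg_right hsρ ?_)
      exact mul_nonneg (by linarith) (by linarith)
    rw [← hB2, ← hs] at this
    linarith [show s * ρ * ((s - 1) * ρ) = s * (s - 1) * ρ ^ 2 by ring]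
  set S : Finset (MonoComponent c) := {C | (C.1, ι C.1 C.2) ∈ S₀} with hSdef
  have hcov' : ∀ v, t ≤ #{i | (⟨i, (c.labelGraph i).connectedComponentMk v⟩ :
      MonoComponent c) ∈ S} := by
    intro v
    refine (hcov _ ⟨v, rfl⟩).trans (card_le_card fun i hi => ?_)
    have h := (mem_filter.1 hi).2
    simpa [hSdef, wordOf] using h
  have hScard : #S ≤ #S₀ := by
    refine card_le_card_of_injOn (fun C => (C.1, ι C.1 C.2)) (fun C hC => ?_) ?_
    · simpa [hSdef] using hC
    · rintro ⟨k, C⟩ - ⟨l, D⟩ - hCD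
      simp only [Prod.mk.injEq] at hCD
      obtain ⟨rfl, hCD⟩ := hCD
      rw [hι k hCD]
  -- Here `1 ≤ t` enters; nonemptiness makes the bound `hlarge` strict.
  have hSne : S.Nonempty := by
    obtain ⟨i, hi⟩ := card_pos.1 (ht.trans (hcov' (Classical.arbitrary V)))
    exact ⟨_, (mem_filter.1 hi).2⟩
  have hsum : (n : ℝ) * (n - 1) ≤ ∑ C : MonoComponent c, 2 * (C.numEdges : ℝ) := by
    have h := choose_two_le_sum_numEdges c
    have h' : ((n.choose 2 : ℕ) : ℝ) ≤ ∑ C : MonoComponent c, (C.numEdges : ℝ) := by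
      exact_mod_cast h
    rw [Nat.cast_choose_two] at h'
    rw [← mul_sum]
    linarith
  have hlarge : ∑ C ∈ S, 2 * (C.numEdges : ℝ) < #S * (2 * B) := by
    rw [← nsmul_eq_mul, ← sum_const]
    exact sum_lt_sum_of_nonempty hSne fun C _ => by linarith [hlt C]
  have hsmall : ∑ C ∈ Sᶜ, 2 * (C.numEdges : ℝ) ≤ (s - 1) * ((4 - t) * n) := by
    -- For order `m ≤ s` use `m (m - 1) ≤ m (s - 1)`; for `m ≥ s` use `2 B = s (s - 1) ≤ m (s - 1)`.
    have hC : ∀ C : MonoComponent c, 2 * (C.numEdges : ℝ) ≤ (s - 1) * C.order := by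
      intro C
      have h1 : (C.numEdges : ℝ) ≤ C.order.choose 2 := by exact_mod_cast C.numEdges_le_choose
      rw [Nat.cast_choose_two] at h1
      rcases le_total (C.order : ℝ) s with h | h
      · have := mul_le_mul_of_nonneg_left (sub_le_sub_right h 1) (Nat.cast_nonneg C.order)
        linarith
      · have := mul_le_mul_of_nonneg_right h (sub_nonneg.2 hs1)
        linarith [hlt C]
    refine (sum_le_sum fun C _ => hC C).trans ?_
    rw [← mul_sum]
    refine mul_le_mul_of_nonneg_left ?_ (sub_nonneg.2 hs1)
    have h : (∑ C ∈ Sᶜ, (C.order : ℝ)) + t * n ≤ 4 * n := by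
      exact_mod_cast sum_order_add_le c S t hcov'
    linarith
  have htotal : (n : ℝ) * (n - 1) < #S₀ * (2 * B) + (s - 1) * ((4 - t) * n) := by
    rw [← sum_add_sum_compl S] at hsum
    have : (#S : ℝ) * (2 * B) ≤ #S₀ * (2 * B) := by
      gcongr
    linarith
  have ht4 : (0 : ℝ) ≤ 4 - t := by
    have h4 := (hcov' (Classical.arbitrary V)).trans (card_le_univ _)
    rw [Fintype.card_fin] at h4
    have : (t : ℝ) ≤ 4 := by exact_mod_cast h4
    linarith
  -- Multiplied by `ρ²`, the right side of `htotal` is at most `(#S₀ + (4 - t) ρ) n (n - 1)`, which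
  -- `hweight` bounds by `ρ² n (n - 1)`.
  have h1 : (s - 1) * ρ * ((4 - t) * n * ρ) ≤ (n - 1) * ((4 - t) * n * ρ) := by
    gcongr
  have h2 : ((#S₀ : ℝ) + (4 - t) * ρ) * (n * (n - 1)) ≤ ρ ^ 2 * (n * (n - 1)) := by
    gcongr
  have h3 := mul_lt_mul_of_pos_right htotal (show 0 < ρ ^ 2 by positivity)
  have h4 : (#S₀ : ℝ) * (2 * B) * ρ ^ 2 = #S₀ * (n * (n - 1)) := by
    rw [← hB2]
    ring
  linarith

/-! ### Recognizing Gyárfás's construction -/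

/-- `ℓ v i` is a name for the component of color `i` that contains `v`. -/
def IsNaming {V α : Type*} (c : TopEdgeLabeling V (Fin 4)) (ℓ : V → Fin 4 → α) : Prop :=
  ∀ i u v, ℓ u i = ℓ v i ↔
    (c.labelGraph i).connectedComponentMk u = (c.labelGraph i).connectedComponentMk v

theorem isNaming_wordOf {V : Type*} (c : TopEdgeLabeling V (Fin 4))
    {ι : ∀ k, (c.labelGraph k).ConnectedComponent → ℕ} (hι : ∀ k, Function.Injective (ι k)) :
    IsNaming c (wordOf c ι) :=
  fun i _ _ => (hι i).eq_iff

/-- Points of a common line are adjacent in its color, and the line coordinate is constant along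
walks of that color. -/
theorem isNaming_gyarfas : IsNaming gyarfas lineCoord := by
  intro i p q
  have hadj : ∀ p q, (gyarfas.labelGraph i).Adj p q ↔ p ≠ q ∧ lineCoord p i = lineCoord q i :=
    gyarfas_adj i
  constructor
  · intro h
    by_cases hpq : p = q
    · rw [hpq]
    · exact ConnectedComponent.sound ((hadj p q).2 ⟨hpq, h⟩).reachable
  · intro h
    obtain ⟨w⟩ := ConnectedComponent.exact h
    induction w with
    | nil => rfl
    | cons hvw w ih => exact ((hadj _ _).1 hvw).2.trans (ih (ConnectedComponent.sound w.reachable))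

theorem MonoComponent.verts_nonempty {V K : Type*} {c : TopEdgeLabeling V K}
    (C : MonoComponent c) : C.verts.Nonempty :=
  C.2.nonempty_supp

/-- Two colorings whose vertices realize the same combinations of names, up to a permutation of
the colors and an injective renaming, have the same component structure. -/
theorem sameComponentStructure_of_isNaming {V W α β : Type*} {c : TopEdgeLabeling V (Fin 4)}
    {d : TopEdgeLabeling W (Fin 4)} {ℓ : V → Fin 4 → α} {ℓ' : W → Fin 4 → β} (hℓ : IsNaming c ℓ)
    (hℓ' : IsNaming d ℓ') (σ : Equiv.Perm (Fin 4)) (φ : Fin 4 → β → α)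
    (hφ : ∀ i, Function.Injective (φ i))
    (h : Set.range ℓ = Set.range fun q i => φ i (ℓ' q (σ i))) : SameComponentStructure c d := by
  have hV : ∀ v, ∃ q, (fun i => φ i (ℓ' q (σ i))) = ℓ v := fun v => h.le ⟨v, rfl⟩
  have hW : ∀ q, ∃ v, ℓ v = fun i => φ i (ℓ' q (σ i)) := fun q => h.ge ⟨q, rfl⟩
  choose g hg using hV
  choose r hr using hW
  choose x hx using fun C : MonoComponent c => C.verts_nonempty
  let f : MonoComponent c → MonoComponent d := fun C =>
    ⟨σ C.1, (d.labelGraph (σ C.1)).connectedComponentMk (g (x C))⟩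
  -- Vertices with corresponding words lie in corresponding components. Thus `f` does not depend on
  -- the representatives `x C`, and common vertices transfer both ways.
  have hf : ∀ C v q, (ℓ v = fun i => φ i (ℓ' q (σ i))) → (v ∈ C.verts ↔ q ∈ (f C).verts) := by
    intro C v q hvq
    rw [MonoComponent.mem_verts, MonoComponent.mem_verts, ← MonoComponent.mem_verts.1 (hx C),
      ← hℓ, ← hℓ', hvq, ← hg]
    exact (hφ _).eq_iff
  have hinj : Function.Injective f := by
    intro C D hCD
    have hmem := (hf C _ _ (hg (x C)).symm).1 (hx C)
    rw [hCD] at hmem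
    exact MonoComponent.eq_of_mem_verts (hx C) ((hf D _ _ (hg (x C)).symm).2 hmem)
      (σ.injective (congrArg Sigma.fst hCD))
  have hsurj : Function.Surjective f := by
    intro D
    obtain ⟨q, hq⟩ := D.verts_nonempty
    refine ⟨⟨σ.symm D.1, (c.labelGraph (σ.symm D.1)).connectedComponentMk (r q)⟩, ?_⟩
    refine MonoComponent.eq_of_mem_verts ((hf _ _ q (hr q)).1 rfl) hq ?_
    exact σ.apply_symm_apply D.1
  refine ⟨σ, Equiv.ofBijective f ⟨hinj, hsurj⟩, fun _ => rfl, fun S => ?_⟩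
  simp only [Set.Nonempty, Set.mem_iInter]
  constructor
  · rintro ⟨v, hv⟩
    exact ⟨g v, fun C hC => (hf C _ _ (hg v).symm).1 (hv C hC)⟩
  · rintro ⟨q, hq⟩
    exact ⟨r q, fun C hC => (hf C _ _ (hr q)).2 (hq C hC)⟩

theorem sameComponentStructure_gyarfas_of_isAffinePlane {V : Type*}
    {c : TopEdgeLabeling V (Fin 4)} {ι : ∀ k, (c.labelGraph k).ConnectedComponent → ℕ}
    (hι : ∀ k, Function.Injective (ι k)) (h : IsAffinePlane (Set.range (wordOf c ι))) :
    SameComponentStructure c gyarfas := by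
  obtain ⟨σ, φ, hφ, h⟩ := h
  exact sameComponentStructure_of_isNaming (isNaming_wordOf c hι) isNaming_gyarfas σ φ hφ h

/-- A component is determined by its color and the line coordinate of any of its points: `4 * 3`
possibilities. -/
theorem card_monoComponent_gyarfas_le : Nat.card (MonoComponent gyarfas) ≤ 12 := by
  choose x hx using fun C : MonoComponent gyarfas => C.verts_nonempty
  have hinj : Function.Injective fun C : MonoComponent gyarfas => (C.1, lineCoord (x C) C.1) := by
    rintro C D hCD
    simp only [Prod.mk.injEq] at hCD
    refine MonoComponent.eq_of_mem_verts (hx C) (?_ : x C ∈ D.verts) hCD.1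
    rw [MonoComponent.mem_verts, ← MonoComponent.mem_verts.1 (hx D), ← isNaming_gyarfas, ← hCD.2,
      hCD.1]
  refine (Nat.card_le_card_of_injective _ hinj).trans ?_
  simp

/-- A coloring with the structure of Gyárfás's construction has only twelve components. -/
theorem exists_numEdges_ge_of_sameComponentStructure {V : Type*} [Fintype V] [Nonempty V]
    {c : TopEdgeLabeling V (Fin 4)} (h : SameComponentStructure c gyarfas) :
    ∃ C : MonoComponent c,
      (1 / 12 : ℝ) * ((Fintype.card V).choose 2 : ℝ) ≤ (C.numEdges : ℝ) := by
  obtain ⟨-, f, -, -⟩ := h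
  have := Fintype.ofFinite (MonoComponent c)
  by_contra! hlt
  have hcard : (Fintype.card (MonoComponent c) : ℝ) ≤ 12 := by
    rw [← Nat.card_eq_fintype_card, Nat.card_congr f]
    exact_mod_cast card_monoComponent_gyarfas_le
  have h1 : ((Fintype.card V).choose 2 : ℝ) ≤ ∑ C : MonoComponent c, (C.numEdges : ℝ) := by
    exact_mod_cast choose_two_le_sum_numEdges c
  have h2 := sum_lt_sum_of_nonempty univ_nonempty fun C (_ : C ∈ univ) => hlt C
  rw [sum_const, nsmul_eq_mul, card_univ] at h2
  have h3 : (0 : ℝ) ≤ 1 / 12 * ((Fintype.card V).choose 2 : ℝ) := by positivity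
  have h4 := mul_le_mul_of_nonneg_right hcard h3
  linarith

/-! ### The numerical gap and the conclusion -/

theorem one_div_twelve_add_lt : (1 / 12 + 0.0007 : ℝ) < 2 / (14 + √96) := by
  have h : √96 < 9.798 := by
    rw [Real.sqrt_lt' (by norm_num)]
    norm_num
  rw [lt_div_iff₀ (by positivity)]
  nlinarith

/-- A four-coloring has the structure of Gyárfás's construction or a component with many edges. -/
theorem exists_numEdges_ge_of_not_sameComponentStructure {V : Type*} [Fintype V] [Nonempty V]
    {c : TopEdgeLabeling V (Fin 4)} (h : ¬ SameComponentStructure c gyarfas) :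
    ∃ C : MonoComponent c,
      (2 / (14 + √96) : ℝ) * ((Fintype.card V).choose 2 : ℝ) ≤ (C.numEdges : ℝ) := by
  choose ι hι using fun k : Fin 4 => exists_injective_nat (c.labelGraph k).ConnectedComponent
  rcases (isIntersecting_range_wordOf c ι).hasSmallCover_or_isAffinePlane with hH | hH
  · exact exists_numEdges_ge_of_hasSmallCover c ι hι hH
  · exact absurd (sameComponentStructure_gyarfas_of_isAffinePlane hι hH) h

theorem exists_numEdges_ge_choose_div_twelve {V : Type*} [Fintype V] [Nonempty V]
    (c : TopEdgeLabeling V (Fin 4)) :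
    ∃ C : MonoComponent c,
      (1 / 12 : ℝ) * ((Fintype.card V).choose 2 : ℝ) ≤ (C.numEdges : ℝ) := by
  by_cases h : SameComponentStructure c gyarfas
  · exact exists_numEdges_ge_of_sameComponentStructure h
  · obtain ⟨C, hC⟩ := exists_numEdges_ge_of_not_sameComponentStructure h
    refine ⟨C, le_trans ?_ hC⟩
    refine mul_le_mul_of_nonneg_right ?_ (Nat.cast_nonneg _)
    linarith [one_div_twelve_add_lt]

end ColoredComponents

theorem theorem1p2 (n : ℕ) (hn : 1 ≤ n) :
    (∀ c : SimpleGraph.TopEdgeLabeling (Fin n) (Fin 4),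
      ∃ C : ColoredComponents.MonoComponent c,
        (1 / 12 : ℝ) * (n.choose 2 : ℝ) ≤ (C.numEdges : ℝ)) ∧
    ⌈(1 / 12 : ℝ) * (n.choose 2 : ℝ)⌉₊ ≤ ColoredComponents.M n 4 ∧
    (∀ c : SimpleGraph.TopEdgeLabeling (Fin n) (Fin 4),
      ¬ ColoredComponents.SameComponentStructure c ColoredComponents.gyarfas →
      ∃ C : ColoredComponents.MonoComponent c,
        (2 / (14 + √96) : ℝ) * (n.choose 2 : ℝ) ≤ (C.numEdges : ℝ)) ∧
    (1 / 12 + 0.0007 : ℝ) < 2 / (14 + √96) := by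
  have : Nonempty (Fin n) := ⟨⟨0, hn⟩⟩
  have h : ∀ c : SimpleGraph.TopEdgeLabeling (Fin n) (Fin 4),
      ∃ C : ColoredComponents.MonoComponent c,
        (1 / 12 : ℝ) * (n.choose 2 : ℝ) ≤ (C.numEdges : ℝ) := fun c => by
    simpa using ColoredComponents.exists_numEdges_ge_choose_div_twelve c
  refine ⟨h, ?_, fun c hc => ?_, ColoredComponents.one_div_twelve_add_lt⟩
  · refine (ColoredComponents.isGreatest_M n 4 hn (by norm_num)).2 fun c => ?_
    obtain ⟨C, hC⟩ := h c
    exact ⟨C, Nat.ceil_le.2 hC⟩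
  · simpa using ColoredComponents.exists_numEdges_ge_of_not_sameComponentStructure hc
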